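/- Let $M\in\mathbb{N}$, $\mathcal{M}=\{1,\ldots,M\}$, and let $\{g(t)\}_{t\in\mathbb{N}_0}$ be a time-homogeneous irreducible Markov chain with values in a finite set $\mathcal{S}$ and with deterministic initial state $g(0)=g_0\in\mathcal{S}$, defined on a probability space $(\Omega,\mathcal{F},\mathbb{P})$. Let $\mathcal{S}_1,\ldots,\mathcal{S}_M$ form a partition of $\mathcal{S}$, i.e., $\bigcup_{i=1}^{M}\mathcal{S}_i=\mathcal{S}$ and $\mathcal{S}_i\cap\mathcal{S}_j=\emptyset$ for $i\neq j$, and define the mode signal $\{r(t)\in\mathcal{M}\}_{t\in\mathbb{N}_0}$ by $r(t)=s$ if $g(t)\in\mathcal{S}_s$, $s\in\mathcal{M}$. For $h\in\mathbb{N}=\{1,2,\ldots\}$ let $$\bar r(i)=\bigl(r(ih),r(ih+1),\ldots,r((i+1)h-1)\bigr)\in\mathcal{M}^h,\qquad i\in\mathbb{N}_0,$$ denote the consecutive non-overlapping $h$-length blocks of $r$. Then for every $h\in\mathbb{N}$ and every $q\in\mathcal{M}^h$ the limit $$\lim_{k\to\infty}\frac1k\sum_{i=0}^{k-1}\mathbf{1}[\bar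 r(i)=q]$$ exists, that is, the averages $\frac1k\sum_{i=0}^{k-1}\mathbf{1}[\bar r(i)=q]$ converge almost surely to a random variable as $k\to\infty$. -/

import Mathlib

open MeasureTheory ProbabilityTheory Filter
open scoped Topology

/-- `g` is a (time-homogeneous) Markov chain on the finite state space `S`, with transition
matrix `P` and deterministic initial state `g₀`, on the probability space `(Ω, μ)`: the rows of
`P` are probability vectors, `g 0 = g₀` almost surely, and, given any history
`g 0 = x 0, …, g t = x t` of positive probability, the conditional probability of
`g (t + 1) = s` is `P (x t) s`. -/
structure IsMarkovChain {Ω S : Type*} [MeasurableSpace Ω] [Fintype S] [DecidableEq S]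
    [MeasurableSpace S] (μ : Measure Ω) (g : ℕ → Ω → S) (P : Matrix S S ℝ) (g₀ : S) :
    Prop where
  measurable : ∀ t, Measurable (g t)
  stochastic : P ∈ Matrix.rowStochastic ℝ S
  initial : ∀ᵐ ω ∂μ, g 0 ω = g₀
  markov : ∀ (t : ℕ) (x : ℕ → S) (s : S),
    μ {ω | ∀ k ≤ t, g k ω = x k} ≠ 0 →
      (μ[|{ω | ∀ k ≤ t, g k ω = x k}]).real {ω | g (t + 1) ω = s} = P (x t) s

/-- The `i`-th block `(r (i h), r (i h + 1), …, r ((i + 1) h - 1))` of length `h` of the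
signal `r`. -/
def blockSignal {Ω α : Type*} (r : ℕ → Ω → α) (h i : ℕ) (ω : Ω) : Fin h → α :=
  fun j => r (i * h + j) ω

/-- The relative frequency `(1 / k) ∑_{i < k} 1[block i = q]` of the word `q` among the first `k`
consecutive blocks of length `h` of the signal `r`. -/
noncomputable def blockFrequency {Ω α : Type*} [DecidableEq α] (r : ℕ → Ω → α) {h : ℕ}
    (q : Fin h → α) (k : ℕ) (ω : Ω) : ℝ :=
  (1 / (k : ℝ)) * ∑ i ∈ Finset.range k, if blockSignal r h i ω = q then (1 : ℝ) else 0

/-! Write the indicator of a block as a product `Y i` of functions of the `h` states in it. By the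
Markov property its conditional mean given the past up to time `i * h` is `φ (g (i * h))`, for a
fixed function `φ` on `S`. Put `Q = P ^ h`. The Poisson equation is solvable up to a harmonic part:
`φ = v + (u - Q u)` with `Q v = v`. Hence `Y i = D i + v (g (i * h)) + (u (g (i * h)) - u (g ((i +
1) * h)))`, where `D i` is a bounded martingale difference. The averages of `D` tend to `0` by the
martingale strong law. The process `v (g (i * h))` is a bounded martingale, so it converges almost
surely and so do its Cesàro means. The `u` terms telescope to `O(1 / k)`. The `h`-step chain may be
reducible, for instance by periodicity, so `v` need not be constant and the limit is obtained as a
random variable. -/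

/-- **Kronecker's lemma** for the weights `1 / (i + 1)`. -/
theorem tendsto_average_of_tendsto_sum_div {x : ℕ → ℝ} {l : ℝ}
    (hx : Tendsto (fun n => ∑ i ∈ Finset.range n, (1 / ((i : ℝ) + 1)) * x i) atTop (𝓝 l)) :
    Tendsto (fun n : ℕ => (n : ℝ)⁻¹ * ∑ i ∈ Finset.range n, x i) atTop (𝓝 0) := by
  set s : ℕ → ℝ := fun n => ∑ i ∈ Finset.range n, (1 / ((i : ℝ) + 1)) * x i with hs
  -- Summation by parts: the averages of `x` are `s n` minus the Cesàro mean of `s`, and both tend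
  -- to `l`.
  have key : ∀ n : ℕ, ∑ i ∈ Finset.range n, x i = n * s n - ∑ i ∈ Finset.range n, s i := by
    intro n
    induction n with
    | zero => simp
    | succ n ih =>
      have hn : (n : ℝ) + 1 ≠ 0 := by positivity
      have h1 : s (n + 1) = s n + (1 / ((n : ℝ) + 1)) * x n := by
        simp only [hs, Finset.sum_range_succ]
      rw [Finset.sum_range_succ, Finset.sum_range_succ, ih, h1]
      push_cast
      field_simp
      ring
  have h2 := hx.sub hx.cesaro
  rw [sub_self] at h2
  refine h2.congr' ?_
  filter_upwards [eventually_gt_atTop 0] with n hn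
  have hn' : (n : ℝ) ≠ 0 := by positivity
  rw [key n, mul_sub, inv_mul_cancel_left₀ hn']

/-! ### Strong law for bounded martingale differences -/

section Martingale

variable {Ω : Type*} {m0 : MeasurableSpace Ω} {μ : Measure Ω} [IsProbabilityMeasure μ]
  {𝓕 : Filtration ℕ m0}

/-- A martingale which is bounded in `L²` converges almost surely. -/
theorem MeasureTheory.Martingale.exists_ae_tendsto_of_integral_sq_le {N : ℕ → Ω → ℝ}
    (hN : Martingale N 𝓕 μ) (hsq : ∀ n, Integrable (fun ω => N n ω ^ 2) μ) {R : ℝ}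
    (hR : ∀ n, ∫ ω, N n ω ^ 2 ∂μ ≤ R) :
    ∀ᵐ ω ∂μ, ∃ l, Tendsto (fun n => N n ω) atTop (𝓝 l) := by
  -- The `L¹` bound `1 + R` comes from `|x| ≤ 1 + x ^ 2`.
  refine hN.submartingale.exists_ae_tendsto_of_bdd (R := (1 + R).toNNReal) fun n => ?_
  rw [eLpNorm_one_eq_lintegral_enorm, ← ofReal_integral_norm_eq_lintegral_enorm (hN.integrable n)]
  refine ENNReal.ofReal_le_ofReal ?_
  calc ∫ ω, ‖N n ω‖ ∂μ ≤ ∫ ω, (1 + N n ω ^ 2) ∂μ := by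
        refine integral_mono (hN.integrable n).norm ((integrable_const _).add (hsq n)) fun ω => ?_
        simp only [Real.norm_eq_abs]
        nlinarith [sq_abs (N n ω), sq_nonneg (|N n ω| - 1), abs_nonneg (N n ω)]
    _ ≤ 1 + R := by
        rw [integral_add (integrable_const _) (hsq n)]
        simpa using hR n

/-- **Strong law of large numbers** for bounded martingale differences. -/
theorem ae_tendsto_average_of_condExp_eq_zero {D : ℕ → Ω → ℝ} {C : ℝ}
    (hD : ∀ i, StronglyMeasurable[𝓕 (i + 1)] (D i)) (hC : ∀ i ω, |D i ω| ≤ C)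
    (h0 : ∀ i, μ[D i | 𝓕 i] =ᵐ[μ] 0) :
    ∀ᵐ ω ∂μ, Tendsto (fun n : ℕ => (n : ℝ)⁻¹ * ∑ i ∈ Finset.range n, D i ω) atTop (𝓝 0) := by
  -- The weights are square-summable, which bounds `N` in `L²`; Kronecker's lemma then removes them.
  set N : ℕ → Ω → ℝ := fun n ω => ∑ i ∈ Finset.range n, (1 / ((i : ℝ) + 1)) * D i ω with hNdef
  have hNsucc : ∀ n, N (n + 1) = N n + (1 / ((n : ℝ) + 1)) • D n := by
    intro n
    ext ω
    simp [hNdef, Finset.sum_range_succ]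
  have hDm : ∀ i, StronglyMeasurable (D i) := fun i => (hD i).mono (𝓕.le _)
  have hDint : ∀ i, Integrable (D i) μ := fun i =>
    Integrable.of_bound (hDm i).aestronglyMeasurable C (ae_of_all _ (hC i))
  have hadp : StronglyAdapted 𝓕 N := by
    intro n
    refine Finset.stronglyMeasurable_fun_sum _ fun i hi => ?_
    exact ((hD i).mono (𝓕.mono (Finset.mem_range.1 hi))).const_mul _
  have hNm : ∀ n, StronglyMeasurable (N n) := fun n => (hadp n).mono (𝓕.le _)
  have hNbd : ∀ n, ∃ B, ∀ ω, |N n ω| ≤ B := by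
    intro n
    refine ⟨∑ i ∈ Finset.range n, |1 / ((i : ℝ) + 1)| * C, fun ω => ?_⟩
    refine (Finset.abs_sum_le_sum_abs _ _).trans (Finset.sum_le_sum fun i _ => ?_)
    rw [abs_mul]
    exact mul_le_mul_of_nonneg_left (hC i ω) (abs_nonneg _)
  have hNint : ∀ n, Integrable (N n) μ := fun n =>
    Integrable.of_bound (hNm n).aestronglyMeasurable _ (ae_of_all _ (hNbd n).choose_spec)
  have hsq : ∀ n, Integrable (fun ω => N n ω ^ 2) μ := by
    intro n
    obtain ⟨B, hB⟩ := hNbd n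
    refine Integrable.of_bound ((hNm n).pow 2).aestronglyMeasurable (B ^ 2)
      (ae_of_all _ fun ω => ?_)
    simpa using pow_le_pow_left₀ (abs_nonneg _) (hB ω) 2
  have hmul : ∀ n, Integrable (N n * D n) μ := by
    intro n
    obtain ⟨B, hB⟩ := hNbd n
    exact (hDint n).bdd_mul (hNm n).aestronglyMeasurable (ae_of_all _ hB)
  have hDsq : ∀ n, Integrable (fun ω => D n ω ^ 2) μ := by
    intro n
    refine Integrable.of_bound ((hDm n).pow 2).aestronglyMeasurable (C ^ 2)
      (ae_of_all _ fun ω => ?_)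
    simpa using pow_le_pow_left₀ (abs_nonneg _) (hC n ω) 2
  -- The increment is orthogonal to the past, so second moments add up without cross terms.
  have horth : ∀ n, ∫ ω, (N n * D n) ω ∂μ = 0 := by
    intro n
    rw [← integral_condExp (𝓕.le n)]
    have h1 : μ[N n * D n | 𝓕 n] =ᵐ[μ] 0 := by
      filter_upwards [condExp_mul_of_stronglyMeasurable_left (hadp n) (hmul n) (hDint n), h0 n]
        with ω h1 h2
      rw [h1, Pi.mul_apply, h2, Pi.zero_apply, mul_zero]
    rw [integral_congr_ae h1]
    simp
  have hmart : Martingale N 𝓕 μ := by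
    refine martingale_of_condExp_sub_eq_zero_nat hadp hNint fun i => ?_
    rw [hNsucc, add_sub_cancel_left]
    filter_upwards [condExp_smul (μ := μ) (1 / ((i : ℝ) + 1)) (D i) (𝓕 i), h0 i] with ω h1 h2
    rw [h1, Pi.smul_apply, h2, Pi.zero_apply, smul_zero]
  have hsum : Summable fun i : ℕ => (1 / ((i : ℝ) + 1)) ^ 2 * C ^ 2 := by
    refine Summable.mul_right _ ?_
    have := (summable_nat_add_iff 1).2 (Real.summable_one_div_nat_pow.2 (one_lt_two))
    simpa using this
  have hbound : ∀ n, ∫ ω, N n ω ^ 2 ∂μ ≤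
      ∑ i ∈ Finset.range n, (1 / ((i : ℝ) + 1)) ^ 2 * C ^ 2 := by
    intro n
    induction n with
    | zero => simp [hNdef]
    | succ n ih =>
      rw [Finset.sum_range_succ]
      set c : ℝ := 1 / ((n : ℝ) + 1)
      have h1 : ∀ ω, N (n + 1) ω ^ 2 = N n ω ^ 2 + 2 * c * (N n * D n) ω + c ^ 2 * D n ω ^ 2 := by
        intro ω
        rw [hNsucc]
        simp only [Pi.add_apply, Pi.smul_apply, Pi.mul_apply, smul_eq_mul]
        ring
      have h2 : ∫ ω, D n ω ^ 2 ∂μ ≤ C ^ 2 := by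
        have := integral_mono (hDsq n) (integrable_const (C ^ 2))
          (fun ω => sq_le_sq' (abs_le.1 (hC n ω)).1 (abs_le.1 (hC n ω)).2)
        simpa using this
      have h3 : Integrable (fun ω => N n ω ^ 2 + 2 * c * (N n * D n) ω) μ :=
        (hsq n).add ((hmul n).const_mul _)
      simp_rw [h1]
      rw [integral_add h3 ((hDsq n).const_mul _),
        integral_add (hsq n) ((hmul n).const_mul _), integral_const_mul, integral_const_mul,
        horth, mul_zero, add_zero]
      exact add_le_add ih (mul_le_mul_of_nonneg_left h2 (sq_nonneg _))
  have hconv := hmart.exists_ae_tendsto_of_integral_sq_le hsq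
    fun n => (hbound n).trans (hsum.sum_le_tsum _ fun i _ => by positivity)
  filter_upwards [hconv] with ω ⟨l, hl⟩
  exact tendsto_average_of_tendsto_sum_div hl

end Martingale

/-! ### Poisson equation of a stochastic matrix -/

section Stochastic

variable {S : Type*} [Fintype S] [DecidableEq S]

open scoped Matrix

theorem Matrix.abs_mulVec_le_of_mem_rowStochastic {Q : Matrix S S ℝ}
    (hQ : Q ∈ Matrix.rowStochastic ℝ S) {w : S → ℝ} {C : ℝ} (hw : ∀ s, |w s| ≤ C) (s : S) :
    |(Q *ᵥ w) s| ≤ C := by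
  calc |∑ j, Q s j * w j| ≤ ∑ j, Q s j * C := by
        refine (Finset.abs_sum_le_sum_abs _ _).trans (Finset.sum_le_sum fun j _ => ?_)
        rw [abs_mul, abs_of_nonneg (Matrix.nonneg_of_mem_rowStochastic hQ)]
        exact mul_le_mul_of_nonneg_left (hw j) (Matrix.nonneg_of_mem_rowStochastic hQ)
    _ = C := by rw [← Finset.sum_mul, Matrix.sum_row_of_mem_rowStochastic hQ, one_mul]

theorem Matrix.pow_mulVec_of_mulVec_eq_self {Q : Matrix S S ℝ} {v : S → ℝ} (hv : Q *ᵥ v = v)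
    (n : ℕ) : Q ^ n *ᵥ v = v := by
  induction n with
  | zero => simp
  | succ n ih => rw [pow_succ, ← Matrix.mulVec_mulVec, hv, ih]

/-- Solvability of the Poisson equation of a stochastic matrix up to a harmonic function. -/
theorem Matrix.exists_eq_add_sub_mulVec_of_mem_rowStochastic {Q : Matrix S S ℝ}
    (hQ : Q ∈ Matrix.rowStochastic ℝ S) (f : S → ℝ) :
    ∃ v u : S → ℝ, Q *ᵥ v = v ∧ f = v + (u - Q *ᵥ u) := by
  set T : (S → ℝ) →ₗ[ℝ] (S → ℝ) := LinearMap.id - Q.mulVecLin with hT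
  have hTapp : ∀ w, T w = w - Q *ᵥ w := fun w => rfl
  have hker : ∀ w, w ∈ LinearMap.ker T ↔ Q *ᵥ w = w := fun w => by
    rw [LinearMap.mem_ker, hTapp, sub_eq_zero, eq_comm]
  -- If `v = w - Q w` is harmonic, then `Q ^ n w = w - n v`; the left side stays bounded by `‖w‖`,
  -- which forces `v = 0`. Rank-nullity then makes kernel and range complementary.
  have hdisj : Disjoint (LinearMap.ker T) (LinearMap.range T) := by
    rw [Submodule.disjoint_def]
    rintro v hv ⟨w, rfl⟩
    set v := T w with hvdef
    have hv : Q *ᵥ v = v := (hker v).1 hv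
    have hpow : ∀ n : ℕ, Q ^ n *ᵥ w = w - (n : ℝ) • v := by
      intro n
      induction n with
      | zero => simp
      | succ n ih =>
        have : Q *ᵥ w = w - v := by rw [hvdef, hTapp, sub_sub_cancel]
        rw [pow_succ, ← Matrix.mulVec_mulVec, this, Matrix.mulVec_sub, ih,
          Matrix.pow_mulVec_of_mulVec_eq_self hv]
        push_cast
        rw [add_smul, one_smul, sub_sub]
    ext s
    by_contra hne
    have hpos : 0 < |v s| := abs_pos.2 hne
    have hw : ∀ s, |w s| ≤ ‖w‖ := fun s => norm_le_pi_norm w s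
    obtain ⟨n, hn⟩ := exists_nat_gt (2 * ‖w‖ / |v s|)
    rw [div_lt_iff₀ hpos] at hn
    have h1 := Matrix.abs_mulVec_le_of_mem_rowStochastic (pow_mem hQ n) hw s
    have h2 : (n : ℝ) * |v s| = |w s - (Q ^ n *ᵥ w) s| := by
      rw [hpow n]
      simp [abs_mul]
    have h3 := abs_sub (w s) ((Q ^ n *ᵥ w) s)
    linarith [hw s]
  have htop : LinearMap.ker T ⊔ LinearMap.range T = ⊤ :=
    ((Submodule.isCompl_iff_disjoint _ _ (by
      rw [add_comm, LinearMap.finrank_range_add_finrank_ker])).2 hdisj).sup_eq_top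
  obtain ⟨v, hv, _, ⟨u, rfl⟩, h⟩ := Submodule.mem_sup.1 (htop ▸ Submodule.mem_top : f ∈ _)
  exact ⟨v, u, (hker v).1 hv, h.symm⟩

end Stochastic

/-! ### Natural filtration of the chain -/

section History

variable {Ω S : Type*} [MeasurableSpace S]

/-- The history `(g 0, …, g t)` of the process `g` up to time `t`. -/
def history (g : ℕ → Ω → S) (t : ℕ) (ω : Ω) (k : Set.Iic t) : S :=
  g k ω

theorem measurable_comap_history (g : ℕ → Ω → S) {k t : ℕ} (hkt : k ≤ t) :
    Measurable[MeasurableSpace.comap (history g t) MeasurableSpace.pi] (g k) :=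
  (measurable_pi_apply (⟨k, hkt⟩ : Set.Iic t)).comp (comap_measurable (history g t))

variable [m0 : MeasurableSpace Ω]

theorem measurable_history {g : ℕ → Ω → S} (hg : ∀ t, Measurable (g t)) (t : ℕ) :
    Measurable (history g t) :=
  measurable_pi_lambda _ fun k => hg k

/-- The filtration whose `t`-th `σ`-algebra is generated by `g 0, …, g t`. -/
def historyFiltration (g : ℕ → Ω → S) (hg : ∀ t, Measurable (g t)) : Filtration ℕ m0 where
  seq t := MeasurableSpace.comap (history g t) MeasurableSpace.pi
  mono' _ _ hst := Measurable.comap_le <| @measurable_pi_lambda _ _ _ (_) _ _ fun k =>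
    measurable_comap_history g (le_trans k.2 hst)
  le' t := (measurable_history hg t).comap_le

theorem measurable_historyFiltration {g : ℕ → Ω → S} (hg : ∀ t, Measurable (g t)) {k t : ℕ}
    (hkt : k ≤ t) : Measurable[historyFiltration g hg t] (g k) :=
  measurable_comap_history g hkt

theorem stronglyMeasurable_historyFiltration [DiscreteMeasurableSpace S] {g : ℕ → Ω → S}
    (hg : ∀ t, Measurable (g t)) {k t : ℕ} (hkt : k ≤ t) (b : S → ℝ) :
    StronglyMeasurable[historyFiltration g hg t] fun ω => b (g k ω) :=
  ((Measurable.of_discrete (f := b)).comp (measurable_historyFiltration hg hkt)).stronglyMeasurable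

end History

section Transition

variable {S : Type*} [Fintype S]

open scoped Matrix

/-- The function `s ↦ 𝔼ₛ[a 0 (g 0) ⋯ a (n - 1) (g (n - 1)) b (g n)]`, for the Markov chain `g`
with transition matrix `P`. -/
def weightedTransition (P : Matrix S S ℝ) (a : ℕ → S → ℝ) : ℕ → (S → ℝ) → S → ℝ
  | 0, b => b
  | n + 1, b => weightedTransition P a n (a n * (P *ᵥ b))

theorem weightedTransition_one [DecidableEq S] (P : Matrix S S ℝ) (n : ℕ) (b : S → ℝ) :
    weightedTransition P 1 n b = P ^ n *ᵥ b := by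
  induction n generalizing b with
  | zero => simp [weightedTransition]
  | succ n ih =>
    rw [weightedTransition, ih, pow_succ, ← Matrix.mulVec_mulVec, Pi.one_apply, one_mul]

end Transition

theorem integrable_comp_of_finite {Ω S : Type*} [MeasurableSpace Ω] {μ : Measure Ω}
    [IsFiniteMeasure μ] [Fintype S] [MeasurableSpace S] [DiscreteMeasurableSpace S] {X : Ω → S}
    (hX : Measurable X) (b : S → ℝ) :
    Integrable (fun ω => b (X ω)) μ := by
  exact Integrable.of_bound
    ((Measurable.of_discrete (f := b)).comp hX).stronglyMeasurable.aestronglyMeasurable ‖b‖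
    (ae_of_all _ fun ω => norm_le_pi_norm b _)

/-! ### Markov property as conditional expectation -/

section MarkovChain

variable {Ω S : Type*} [m0 : MeasurableSpace Ω] {μ : Measure Ω} [IsProbabilityMeasure μ]
  [Fintype S] [DecidableEq S] [MeasurableSpace S] [DiscreteMeasurableSpace S]
  {g : ℕ → Ω → S} {P : Matrix S S ℝ} {g₀ : S}

open scoped Matrix

namespace IsMarkovChain

/-- On a single history the current state is constant, so expanding `b` in indicators of states
reduces the claim to the elementary Markov property; null histories contribute zero to both sides.
-/
theorem setIntegral_history (hg : IsMarkovChain μ g P g₀) (t : ℕ) (x : ℕ → S) (b : S → ℝ) :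
    ∫ ω in {ω | ∀ k ≤ t, g k ω = x k}, b (g (t + 1) ω) ∂μ =
      ∫ ω in {ω | ∀ k ≤ t, g k ω = x k}, (P *ᵥ b) (g t ω) ∂μ := by
  set A : Set Ω := {ω | ∀ k ≤ t, g k ω = x k} with hA
  have hAm : MeasurableSet A := by
    have : A = ⋂ k ∈ Set.Iic t, g k ⁻¹' {x k} := by ext; simp [hA]
    rw [this]
    exact MeasurableSet.biInter (Set.to_countable _) fun k _ => hg.measurable k (.of_discrete)
  by_cases h0 : μ A = 0
  · rw [setIntegral_measure_zero _ h0, setIntegral_measure_zero _ h0]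
  have hE : ∀ s, MeasurableSet {ω | g (t + 1) ω = s} := fun s =>
    hg.measurable (t + 1) (MeasurableSet.of_discrete (s := {s}))
  have hcond : ∀ s, μ.real (A ∩ {ω | g (t + 1) ω = s}) = μ.real A * P (x t) s := by
    intro s
    rw [← hg.markov t x s h0, measureReal_def, measureReal_def, measureReal_def,
      cond_apply hAm, ENNReal.toReal_mul, ENNReal.toReal_inv, mul_inv_cancel_left₀]
    exact ENNReal.toReal_ne_zero.2 ⟨h0, measure_ne_top _ _⟩
  have h1 : ∀ ω, b (g (t + 1) ω) =
      ∑ s, b s * ({ω | g (t + 1) ω = s}.indicator (fun _ => (1 : ℝ)) ω) := by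
    intro ω
    simp [Set.indicator_apply]
  have h2 : ∫ ω in A, (P *ᵥ b) (g t ω) ∂μ = ∫ _ in A, (P *ᵥ b) (x t) ∂μ :=
    setIntegral_congr_fun hAm fun ω hω => by simp only [hω t le_rfl]
  simp_rw [h1]
  rw [h2, setIntegral_const, integral_finsetSum]
  · simp_rw [integral_const_mul]
    rw [smul_eq_mul, Matrix.mulVec, dotProduct, Finset.mul_sum]
    refine Finset.sum_congr rfl fun s _ => ?_
    rw [setIntegral_indicator (hE s), setIntegral_const, hcond s, smul_eq_mul]
    ring
  · intro s _
    exact (((integrable_const (1 : ℝ)).indicator (hE s)).const_mul _).integrableOn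

/-- The **Markov property**, in terms of the conditional expectation given the past. -/
theorem condExp_succ (hg : IsMarkovChain μ g P g₀) (t : ℕ) (b : S → ℝ) :
    μ[fun ω => b (g (t + 1) ω) | historyFiltration g hg.measurable t] =ᵐ[μ]
      fun ω => (P *ᵥ b) (g t ω) := by
  have hb := integrable_comp_of_finite (μ := μ) (hg.measurable (t + 1)) b
  have hPb := integrable_comp_of_finite (μ := μ) (hg.measurable t) (P *ᵥ b)
  refine (ae_eq_condExp_of_forall_setIntegral_eq ((historyFiltration g hg.measurable).le t) hb
    (fun _ _ _ => hPb.integrableOn) ?_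
    (stronglyMeasurable_historyFiltration hg.measurable le_rfl _).aestronglyMeasurable).symm
  rintro _ ⟨B, -, rfl⟩ -
  -- There are finitely many histories up to time `t`, so every event of the past is a finite
  -- disjoint union of them.
  have hunion : history g t ⁻¹' B = ⋃ y ∈ B.toFinite.toFinset, history g t ⁻¹' {y} := by ext; simp
  have hdisj : (B.toFinite.toFinset : Set (Set.Iic t → S)).Pairwise
      (Function.onFun Disjoint fun y => history g t ⁻¹' {y}) := fun y _ z _ hyz =>
    Disjoint.preimage (history g t) (Set.disjoint_singleton.2 hyz)
  have hmeas : ∀ y ∈ B.toFinite.toFinset, MeasurableSet (history g t ⁻¹' {y}) := fun y _ =>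
    measurable_history hg.measurable t (measurableSet_singleton y)
  rw [hunion, integral_biUnion_finset _ hmeas hdisj fun _ _ => hPb.integrableOn,
    integral_biUnion_finset _ hmeas hdisj fun _ _ => hb.integrableOn]
  refine Finset.sum_congr rfl fun y _ => ?_
  have hy : history g t ⁻¹' {y} =
      {ω | ∀ k ≤ t, g k ω = if hk : k ≤ t then y ⟨k, hk⟩ else g₀} := by
    ext ω
    simp only [Set.mem_preimage, Set.mem_singleton_iff, funext_iff, Set.mem_ofPred_eq, history]
    exact ⟨fun h k hk => by rw [dif_pos hk]; exact h ⟨k, hk⟩,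
      fun h k => by have := h k k.2; rwa [dif_pos (show (k : ℕ) ≤ t from k.2)] at this⟩
  rw [hy]
  exact (hg.setIntegral_history t _ b).symm

end IsMarkovChain

/-- The Markov property for products of functions of finitely many future states. -/
theorem IsMarkovChain.condExp_prod_mul (hg : IsMarkovChain μ g P g₀) (a : ℕ → S → ℝ) (t n : ℕ)
    (b : S → ℝ) :
    μ[fun ω => (∏ j ∈ Finset.range n, a j (g (t + j) ω)) * b (g (t + n) ω) |
        historyFiltration g hg.measurable t] =ᵐ[μ]
      fun ω => weightedTransition P a n b (g t ω) := by
  set 𝓕 := historyFiltration g hg.measurable with h𝓕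
  induction n generalizing b with
  | zero =>
    simp only [Finset.range_zero, Finset.prod_empty, one_mul, add_zero, weightedTransition]
    rw [condExp_of_stronglyMeasurable (𝓕.le t)
      (stronglyMeasurable_historyFiltration hg.measurable le_rfl b)
      (integrable_comp_of_finite (hg.measurable t) b)]
  | succ n ih =>
    set A : Ω → ℝ := fun ω => ∏ j ∈ Finset.range (n + 1), a j (g (t + j) ω) with hAdef
    have hAm : StronglyMeasurable[𝓕 (t + n)] A :=
      Finset.stronglyMeasurable_fun_prod _ fun j hj =>
        stronglyMeasurable_historyFiltration hg.measurable
          (by have := Finset.mem_range.1 hj; omega) (a j)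
    have hAb : ∃ C, ∀ ω, ‖A ω‖ ≤ C := by
      refine ⟨∏ j ∈ Finset.range (n + 1), ‖a j‖, fun ω => ?_⟩
      rw [hAdef, norm_prod]
      exact Finset.prod_le_prod (fun _ _ => norm_nonneg _) fun j _ => norm_le_pi_norm (a j) _
    obtain ⟨C, hC⟩ := hAb
    have hb := integrable_comp_of_finite (μ := μ) (hg.measurable (t + n + 1)) b
    have hAbint : Integrable (A * fun ω => b (g (t + n + 1) ω)) μ :=
      hb.bdd_mul (hAm.mono (𝓕.le _)).aestronglyMeasurable (ae_of_all _ hC)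
    -- Conditioning at time `t + n` replaces the last factor by `P *ᵥ b`, which is absorbed with `a
    -- n` into a new terminal function; the tower property and induction do the rest.
    have hstep : μ[A * fun ω => b (g (t + n + 1) ω) | 𝓕 (t + n)] =ᵐ[μ]
        fun ω => (∏ j ∈ Finset.range n, a j (g (t + j) ω)) * (a n * (P *ᵥ b)) (g (t + n) ω) := by
      filter_upwards [condExp_mul_of_stronglyMeasurable_left hAm hAbint hb,
        hg.condExp_succ (t + n) b] with ω h1 h2
      rw [h1, Pi.mul_apply, h2, hAdef]
      simp only [Finset.prod_range_succ, Pi.mul_apply, mul_assoc]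
    exact (condExp_condExp_of_le (𝓕.mono (Nat.le_add_right t n)) (𝓕.le _)).symm.trans
      ((condExp_congr_ae hstep).trans (ih (a n * (P *ᵥ b))))

theorem IsMarkovChain.condExp_add (hg : IsMarkovChain μ g P g₀) (t n : ℕ) (b : S → ℝ) :
    μ[fun ω => b (g (t + n) ω) | historyFiltration g hg.measurable t] =ᵐ[μ]
      fun ω => (P ^ n *ᵥ b) (g t ω) := by
  simpa [weightedTransition_one] using hg.condExp_prod_mul 1 t n b

end MarkovChain

/-! ### Convergence of block averages -/

section BlockAverage

variable {Ω S : Type*} [m0 : MeasurableSpace Ω] {μ : Measure Ω} [IsProbabilityMeasure μ]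
  [Fintype S] [DecidableEq S] [MeasurableSpace S] [DiscreteMeasurableSpace S]
  {g : ℕ → Ω → S} {P : Matrix S S ℝ} {g₀ : S}

open scoped Matrix

/-- Sampling a filtration along the multiples of `h`. -/
def MeasureTheory.Filtration.sampled (𝓕 : Filtration ℕ m0) (h : ℕ) : Filtration ℕ m0 where
  seq i := 𝓕 (i * h)
  mono' _ _ hij := 𝓕.mono (Nat.mul_le_mul_right h hij)
  le' i := 𝓕.le (i * h)

/-- A harmonic function of a sampled finite Markov chain converges almost surely. -/
theorem IsMarkovChain.exists_ae_tendsto_of_harmonic (hg : IsMarkovChain μ g P g₀) (h : ℕ)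
    {v : S → ℝ} (hv : P ^ h *ᵥ v = v) :
    ∀ᵐ ω ∂μ, ∃ l, Tendsto (fun i => v (g (i * h) ω)) atTop (𝓝 l) := by
  have hint : ∀ b : S → ℝ, ∀ i, Integrable (fun ω => b (g (i * h) ω)) μ := fun b i =>
    integrable_comp_of_finite (hg.measurable _) b
  have hmart : Martingale (fun i ω => v (g (i * h) ω))
      ((historyFiltration g hg.measurable).sampled h) μ := by
    refine martingale_nat
      (fun i => stronglyMeasurable_historyFiltration hg.measurable le_rfl v) (hint v) fun i => ?_
    have := hg.condExp_add (i * h) h v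
    rw [hv] at this
    simp only [Nat.succ_mul]
    exact this.symm
  refine hmart.exists_ae_tendsto_of_integral_sq_le (hint (v ^ 2)) (R := ‖v‖ ^ 2) fun n => ?_
  have := integral_mono (hint (v ^ 2) n) (integrable_const (‖v‖ ^ 2)) fun ω =>
    sq_le_sq' (abs_le.1 (norm_le_pi_norm v (g (n * h) ω))).1
      (abs_le.1 (norm_le_pi_norm v (g (n * h) ω))).2
  simpa using this

/-- The averages of a product function over the consecutive blocks of length `h` of a finite
Markov chain converge almost surely. -/
theorem IsMarkovChain.exists_ae_tendsto_average_prod (hg : IsMarkovChain μ g P g₀) (h : ℕ)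
    (a : ℕ → S → ℝ) :
    ∀ᵐ ω ∂μ, ∃ l, Tendsto (fun k : ℕ => (k : ℝ)⁻¹ *
      ∑ i ∈ Finset.range k, ∏ j ∈ Finset.range h, a j (g (i * h + j) ω)) atTop (𝓝 l) := by
  set 𝓕 := historyFiltration g hg.measurable with h𝓕
  set φ : S → ℝ := weightedTransition P a h 1 with hφ
  obtain ⟨v, u, hv, hvu⟩ :=
    Matrix.exists_eq_add_sub_mulVec_of_mem_rowStochastic (pow_mem hg.stochastic h) φ
  set w : S → ℝ := P ^ h *ᵥ u with hw
  set Y : ℕ → Ω → ℝ := fun i ω => ∏ j ∈ Finset.range h, a j (g (i * h + j) ω) with hY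
  -- The term in `u` at the end of the block has conditional mean `w`, so `D i` is centred given the
  -- past; moreover `φ + w = v + u`.
  set D : ℕ → Ω → ℝ := fun i ω =>
    (Y i ω + u (g (i * h + h) ω)) - (φ + w) (g (i * h) ω) with hD
  have hYm : ∀ i, StronglyMeasurable[𝓕 (i * h + h)] (Y i) := fun i =>
    Finset.stronglyMeasurable_fun_prod _ fun j hj =>
      stronglyMeasurable_historyFiltration hg.measurable
        (by have := Finset.mem_range.1 hj; omega) (a j)
  have hYb : ∀ i ω, |Y i ω| ≤ ∏ j ∈ Finset.range h, ‖a j‖ := by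
    intro i ω
    rw [hY, Finset.abs_prod]
    exact Finset.prod_le_prod (fun _ _ => abs_nonneg _) fun j _ => norm_le_pi_norm (a j) _
  have hYint : ∀ i, Integrable (Y i) μ := fun i =>
    Integrable.of_bound ((hYm i).mono (𝓕.le _)).aestronglyMeasurable _ (ae_of_all _ (hYb i))
  have hint : ∀ (b : S → ℝ) t, Integrable (fun ω => b (g t ω)) μ := fun b t =>
    integrable_comp_of_finite (hg.measurable t) b
  have hD0 : ∀ i, μ[D i | 𝓕.sampled h i] =ᵐ[μ] 0 := by
    intro i
    have h1 : μ[Y i | 𝓕 (i * h)] =ᵐ[μ] fun ω => φ (g (i * h) ω) := by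
      simpa using hg.condExp_prod_mul a (i * h) h 1
    have h2 := hg.condExp_add (i * h) h u
    have h3 := MeasureTheory.condExp_add (hYint i) (hint u (i * h + h)) (𝓕 (i * h))
    have h4 := condExp_sub ((hYint i).add (hint u (i * h + h))) (hint (φ + w) (i * h))
      (𝓕 (i * h))
    have h5 := condExp_of_stronglyMeasurable (μ := μ) (𝓕.le (i * h))
      (stronglyMeasurable_historyFiltration hg.measurable le_rfl (φ + w)) (hint (φ + w) (i * h))
    filter_upwards [h1, h2, h3, h4] with ω h1 h2 h3 h4
    refine h4.trans ?_
    rw [Pi.sub_apply, h3, h5, Pi.add_apply, h1, h2]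
    simp [hw]
  have hDm : ∀ i, StronglyMeasurable[𝓕.sampled h (i + 1)] (D i) := by
    intro i
    have hi : 𝓕.sampled h (i + 1) = 𝓕 (i * h + h) := by rw [← Nat.succ_mul]; rfl
    rw [hi]
    exact ((hYm i).add (stronglyMeasurable_historyFiltration hg.measurable le_rfl u)).sub
      (stronglyMeasurable_historyFiltration hg.measurable (Nat.le_add_right _ _) (φ + w))
  have hDb : ∀ i ω, |D i ω| ≤ (∏ j ∈ Finset.range h, ‖a j‖) + ‖u‖ + ‖φ + w‖ := by
    intro i ω
    refine (abs_sub _ _).trans (add_le_add ((abs_add_le _ _).trans (add_le_add (hYb i ω) ?_)) ?_)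
    · exact norm_le_pi_norm u _
    · exact norm_le_pi_norm (φ + w) _
  filter_upwards [hg.exists_ae_tendsto_of_harmonic h hv,
    ae_tendsto_average_of_condExp_eq_zero hDm hDb hD0] with ω ⟨l, hl⟩ hDlim
  have htel : Tendsto (fun k : ℕ => (k : ℝ)⁻¹ * (u (g 0 ω) - u (g (k * h) ω))) atTop (𝓝 0) := by
    refine tendsto_inv_atTop_nhds_zero_nat.zero_mul_isBoundedUnder_le ?_
    refine isBoundedUnder_of ⟨‖u‖ + ‖u‖, fun k => ?_⟩
    exact (norm_sub_le _ _).trans (add_le_add (norm_le_pi_norm u _) (norm_le_pi_norm u _))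
  refine ⟨0 + l + 0, ((hDlim.add hl.cesaro).add htel).congr fun k => ?_⟩
  rw [← mul_add, ← mul_add]
  congr 1
  induction k with
  | zero => simp
  | succ k ih =>
    have hφk : φ (g (k * h) ω) = v (g (k * h) ω) + (u (g (k * h) ω) - w (g (k * h) ω)) := by
      rw [hvu]; rfl
    simp only [Finset.sum_range_succ, ← ih, Nat.succ_mul, hD, Pi.add_apply, hφk]
    ring

end BlockAverage

theorem proposition1 {Ω S : Type*} [MeasurableSpace Ω] (μ : Measure Ω) [IsProbabilityMeasure μ]
    [Fintype S] [DecidableEq S] [MeasurableSpace S] [DiscreteMeasurableSpace S]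
    (g : ℕ → Ω → S) (P : Matrix S S ℝ) (g₀ : S)
    (hg : IsMarkovChain μ g P g₀) (hP : P.IsIrreducible)
    {M : ℕ} (part : Fin M → Set S)
    (hcover : ⋃ s, part s = Set.univ)
    (hdisj : ∀ s s', s ≠ s' → part s ∩ part s' = ∅)
    (r : ℕ → Ω → Fin M)
    (hr : ∀ t ω s, g t ω ∈ part s → r t ω = s)
    (h : ℕ) (hh : 0 < h) (q : Fin h → Fin M) :
    ∃ L : Ω → ℝ, Measurable L ∧
      ∀ᵐ ω ∂μ, Tendsto (fun k : ℕ => blockFrequency r q k ω) atTop (𝓝 (L ω)) := by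
  classical
  have hmem : ∀ t ω s, r t ω = s ↔ g t ω ∈ part s := by
    refine fun t ω s => ⟨?_, hr t ω s⟩
    rintro rfl
    obtain ⟨s, hs⟩ := Set.mem_iUnion.1 (hcover ▸ Set.mem_univ (g t ω))
    rwa [hr t ω s hs]
  -- The value `1` for `j ≥ h` is a default: the products only run over `j < h`.
  set a : ℕ → S → ℝ := fun j x => if hj : j < h then (if x ∈ part (q ⟨j, hj⟩) then 1 else 0) else 1
    with ha
  have hblock : ∀ k ω, blockFrequency r q k ω = (k : ℝ)⁻¹ *
      ∑ i ∈ Finset.range k, ∏ j ∈ Finset.range h, a j (g (i * h + j) ω) := by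
    intro k ω
    rw [blockFrequency, one_div]
    congr 1
    refine Finset.sum_congr rfl fun i _ => ?_
    rw [← Fin.prod_univ_eq_prod_range (fun j => a j (g (i * h + j) ω))]
    simp only [ha, Fin.is_lt, dif_pos, Fin.eta, ← hmem, Fintype.prod_ite_zero]
    simp [blockSignal, funext_iff]
  have hmeas : ∀ k, Measurable fun ω => blockFrequency r q k ω := by
    intro k
    simp only [hblock]
    refine (Finset.measurable_fun_sum _ fun i _ =>
      Finset.measurable_fun_prod _ fun j _ => ?_).const_mul _
    exact (Measurable.of_discrete (f := a j)).comp (hg.measurable _)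
  -- Pointwise limits, existing almost everywhere, are assembled into one measurable function.
  refine measurable_limit_of_tendsto_metrizable_ae (fun k => (hmeas k).aemeasurable) ?_
  simpa only [hblock] using hg.exists_ae_tendsto_average_prod h a
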